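/- Let $S$ be a cancellative semigroup that is left-amenable, i.e. there is a finitely additive probability measure $\mu$ on the set of all subsets of $S$ with $\mu(\{t \in S : st \in A\}) = \mu(A)$ for all $s \in S$, $A \subset S$. Let $X$ be a compact metrizable space with a continuous action of $S$, i.e. a map $S \times X \to X$, $(s,x) \mapsto sx$, such that $s_1(s_2x) = (s_1s_2)x$ and each $T_s \colon x \mapsto sx$ is continuous. Let $\mathcal{U} = (U_j)_{j \in J}$ be a finite open cover of $X$. For a finite open cover $\mathcal{V} = (V_k)_{k \in K}$ of $X$ put $\operatorname{ord}(\mathcal{V}) := \max_{x \in X} \bigl(-1 + |\{k \in K : x \in V_k\}|\bigr)$ (and $\operatorname{ord}(\mathcal{V}) := 0$ if $X = \varnothing$), and $D(\mathcal{U}) := \min_{\mathcal{V}} \operatorname{ord}(\mathcal{V})$, where $\mathcal{V}$ runs over all finite open covers of $X$ finer than $\mathcal{U}$, i.e. such that each $V_k$ is contained in some $U_j$. For a finite subset $A \subset S$ let $\mathcal{U}_A := \bigvee_{s \in A} T_s^{-1}(\mathcal{U})$ be the finite open cover whose members are the sets $\bigcap_{s \in A} T_s^{-1}(U_{\varphi(s)})$,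 indexed by all maps $\varphi \colon A \to J$ (so $\mathcal{U}_\varnothing = \{X\}$), and put $h^{\dim}_{\mathcal{U}}(A) := D(\mathcal{U}_A)$. A left-Følner net of $S$ is a net $(F_i)_{i \in I}$, indexed by a non-empty directed set, of non-empty finite subsets of $S$ such that $\lim_i |sF_i \setminus F_i|/|F_i| = 0$ for every $s \in S$. Theorem. For every left-Følner net $(F_i)_{i \in I}$ of $S$ the limit $$\eta^{\dim}_{\mathcal{U}} := \lim_i \frac{h^{\dim}_{\mathcal{U}}(F_i)}{|F_i|}$$ exists and is finite. Moreover, $\eta^{\dim}_{\mathcal{U}}$ does not depend on the choice of the left-Følner net. -/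

import Mathlib

open Filter Topology TopologicalSpace

namespace MeanDim

/-- A semigroup `S` is left-amenable if there is a finitely additive left-invariant probability
measure defined on all subsets of `S`. -/
def LeftAmenable (S : Type*) [Semigroup S] : Prop :=
  ∃ μ : Set S → ℝ,
    (∀ A, 0 ≤ μ A ∧ μ A ≤ 1) ∧
    (∀ A B, A ∩ B = ∅ → μ (A ∪ B) = μ A + μ B) ∧
    μ Set.univ = 1 ∧
    ∀ (s : S) (A : Set S), μ ((fun t => s * t) ⁻¹' A) = μ A

open Classical in
/-- A net `F`, indexed by a directed set `I`, of non-empty finite subsets of `S` is a left-Følner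
net if `|s F_i \ F_i| / |F_i|` tends to `0` for every `s ∈ S`. -/
def IsLeftFolnerNet {S : Type*} [Semigroup S] {I : Type*} [Preorder I] (F : I → Finset S) : Prop :=
  (∀ i, (F i).Nonempty) ∧
  ∀ s : S, Tendsto
    (fun i => ((((F i).image (fun t => s * t)) \ F i).card : ℝ) / ((F i).card : ℝ)) atTop (𝓝 0)

/-- The family `V` is finer than the family `U`: each member of `V` is contained in some member
of `U`. -/
def Finer {X : Type*} [TopologicalSpace X] {J K : Type*} (V : K → Opens X) (U : J → Opens X) :
    Prop :=
  ∀ k, ∃ j, V k ≤ U j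

/-- The local order of `U` at `x`: the number of indices `j` with `x ∈ U j`, minus one. -/
noncomputable def localOrder {X : Type*} [TopologicalSpace X] {J : Type*} (U : J → Opens X)
    (x : X) : ℤ :=
  ({j | x ∈ U j}.ncard : ℤ) - 1

/-- The order of a finite family `U`: the maximum over `x` of the local orders. (If `X` is empty,
this is `0`.) -/
noncomputable def order {X : Type*} [TopologicalSpace X] {J : Type*} (U : J → Opens X) : ℤ :=
  ⨆ x : X, localOrder U x

/-- `D(U)`: the minimum of the orders of the finite open covers of `X` that are finer than `U`. -/
noncomputable def D {X : Type*} [TopologicalSpace X] {J : Type*} (U : J → Opens X) : ℤ :=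
  sInf {d : ℤ | ∃ (n : ℕ) (V : Fin n → Opens X), IsOpenCover V ∧ Finer V U ∧ order V = d}

/-- `U_A`, the join over `s ∈ A` of the pullbacks of `U` by `x ↦ s • x`: its members are the sets
`⋂ s ∈ A, {x | s • x ∈ U (φ s)}`, indexed by the maps `φ : A → J`. For `A = ∅` its only member is
`X`. -/
def joinPullback {S X : Type*} [TopologicalSpace X] [Semigroup S] [SemigroupAction S X]
    [ContinuousConstSMul S X] {J : Type*} (U : J → Opens X) (A : Finset S) : (A → J) → Opens X :=
  fun φ => ⟨⋂ s : A, (fun x : X => (s : S) • x) ⁻¹' (U (φ s) : Set X),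
    isOpen_iInter_of_finite fun s => (U (φ s)).isOpen.preimage (continuous_const_smul (s : S))⟩

theorem isOpenCover_joinPullback {S X : Type*} [TopologicalSpace X] [Semigroup S]
    [SemigroupAction S X] [ContinuousConstSMul S X] {J : Type*} {U : J → Opens X}
    (hU : IsOpenCover U) (A : Finset S) : IsOpenCover (joinPullback U A) := by
  rw [IsOpenCover, eq_top_iff]
  intro x _
  have h : ∀ y : X, ∃ j, y ∈ U j := hU.exists_mem
  choose f hf using h
  rw [Opens.mem_iSup]
  exact ⟨fun s => f ((s : S) • x), Set.mem_iInter.2 fun s => hf _⟩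

/-- The function `A ↦ D(U_A)` on the finite subsets of `S`. -/
noncomputable def hdim {S X : Type*} [TopologicalSpace X] [Semigroup S] [SemigroupAction S X]
    [ContinuousConstSMul S X] {J : Type*} (U : J → Opens X) (A : Finset S) : ℝ :=
  (D (joinPullback U A) : ℝ)

end MeanDim

/-! The function `hdim U` is subadditive under unions, does not grow under right translation and is
at most `D U` on singletons. For any such function on a cancellative semigroup, an Ornstein–Weiss
argument gives the limit (`IsSubadditive.tendsto_folnerLimit`). Subadditivity rests on `D_le_add`:
two covers are merged by overlapping the interval subdivisions coming from two partitions of unity,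
so that orders add instead of multiplying. The core of the limit is `eventuallyLe_of_lt`. If
arbitrarily invariant sets `K` satisfy `h K ≤ b * K.card`, a sufficiently invariant `R` is filled by
almost disjoint right translates of such sets, of several shapes in succession, and the small
remainder costs at most `M` per point. So no ratio below the infimum `folnerLimit h` can recur along
a Følner net, and this infimum does not involve the net. -/

namespace MeanDim

/-! ### Orders of finite open covers -/

section Covers

variable {X : Type*} [TopologicalSpace X]

theorem bddAbove_range_localOrder {K : Type*} [Finite K] (V : K → Opens X) :
    BddAbove (Set.range (localOrder V)) := by
  refine ⟨(Nat.card K : ℤ) - 1, ?_⟩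
  rintro _ ⟨x, rfl⟩
  have := Set.ncard_le_card {j | x ∈ V j}
  simp only [localOrder]
  omega

theorem localOrder_le_order {K : Type*} [Finite K] (V : K → Opens X) (x : X) :
    localOrder V x ≤ order V :=
  le_ciSup (bddAbove_range_localOrder V) x

/-- The assumption `0 ≤ d` serves empty `X`, where the integer supremum defaults to `0`. -/
theorem order_le {K : Type*} {V : K → Opens X} {d : ℤ} (hd : 0 ≤ d)
    (h : ∀ x, localOrder V x ≤ d) : order V ≤ d := by
  rcases isEmpty_or_nonempty X with hX | hX
  · rwa [order, iSup_of_empty', Int.csSup_empty]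
  · exact ciSup_le h

theorem order_nonneg {K : Type*} [Finite K] {V : K → Opens X} (hV : IsOpenCover V) :
    0 ≤ order V := by
  rcases isEmpty_or_nonempty X with hX | ⟨⟨x⟩⟩
  · rw [order, iSup_of_empty', Int.csSup_empty]
  · refine le_trans ?_ (localOrder_le_order V x)
    have : 0 < {j | x ∈ V j}.ncard := (Set.ncard_pos (Set.toFinite _)).2 (hV.exists_mem x)
    simp only [localOrder]
    omega

theorem order_comp_equiv {K L : Type*} (V : K → Opens X) (e : L ≃ K) :
    order (fun l => V (e l)) = order V := by
  have h : localOrder (fun l => V (e l)) = localOrder V := by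
    funext x
    have : {l | x ∈ V (e l)} = e ⁻¹' {k | x ∈ V k} := rfl
    simp only [localOrder, this]
    rw [Set.ncard_preimage_of_injective_subset_range e.injective (by simp)]
  simp [order, h]

theorem bddBelow_orders {J : Type*} (U : J → Opens X) : BddBelow {d : ℤ |
    ∃ (n : ℕ) (V : Fin n → Opens X), IsOpenCover V ∧ Finer V U ∧ order V = d} := by
  refine ⟨0, ?_⟩
  rintro _ ⟨n, V, hV, -, rfl⟩
  exact order_nonneg hV

theorem D_le_order {J K : Type*} [Finite K] {U : J → Opens X} {V : K → Opens X}
    (hV : IsOpenCover V) (hVU : Finer V U) : D U ≤ order V := by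
  obtain ⟨n, ⟨e⟩⟩ := Finite.exists_equiv_fin K
  refine csInf_le (bddBelow_orders U) ⟨n, fun l => V (e.symm l), ?_, fun l => hVU _, ?_⟩
  · rw [IsOpenCover, ← hV.iSup_eq_top]
    exact e.symm.iSup_comp
  · exact order_comp_equiv V e.symm

theorem exists_order_eq_D {J : Type*} [Finite J] {U : J → Opens X} (hU : IsOpenCover U) :
    ∃ (n : ℕ) (V : Fin n → Opens X), IsOpenCover V ∧ Finer V U ∧ order V = D U := by
  refine Int.csInf_mem (s := {d : ℤ | ∃ (n : ℕ) (V : Fin n → Opens X),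
    IsOpenCover V ∧ Finer V U ∧ order V = d}) ?_ (bddBelow_orders U)
  obtain ⟨n, ⟨e⟩⟩ := Finite.exists_equiv_fin J
  refine ⟨_, n, fun l => U (e.symm l), ?_, fun l => ⟨_, le_rfl⟩, rfl⟩
  rw [IsOpenCover, ← hU.iSup_eq_top]
  exact e.symm.iSup_comp

theorem D_nonneg {J : Type*} [Finite J] {U : J → Opens X} (hU : IsOpenCover U) : 0 ≤ D U := by
  obtain ⟨n, V, hV, -, h⟩ := exists_order_eq_D hU
  exact h ▸ order_nonneg hV

/-- Pulling back an optimal refinement does not raise multiplicities: the local order at `x` is the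
original one at `f x`. -/
theorem D_le_of_comap_le {Y : Type*} [TopologicalSpace Y] {J J' : Type*} [Finite J']
    {U : J → Opens X} {U' : J' → Opens Y} (hU' : IsOpenCover U') (f : C(X, Y))
    (h : ∀ j', ∃ j, Opens.comap f (U' j') ≤ U j) : D U ≤ D U' := by
  obtain ⟨n, V, hV, hVU, hD⟩ := exists_order_eq_D hU'
  refine (D_le_order (V := fun k => Opens.comap f (V k)) ?_ ?_).trans
    (order_le (D_nonneg hU') fun x => ?_)
  · exact hV.comap f
  · intro k
    obtain ⟨j', hj'⟩ := hVU k
    obtain ⟨j, hj⟩ := h j'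
    exact ⟨j, le_trans (fun x hx => hj' hx) hj⟩
  · exact hD ▸ localOrder_le_order V (f x)

end Covers

/-! ### Overlaps of two subdivisions of an interval -/

section Staircase

variable {n m : ℕ}

/-- The sum of the values of `f` at the indices before `i`. -/
def partialSum (f : Fin n → ℝ) (i : Fin n) : ℝ := ∑ k ∈ Finset.Iio i, f k

theorem partialSum_add_le {f : Fin n → ℝ} (hf : ∀ i, 0 ≤ f i) {i j : Fin n} (hij : i < j) :
    partialSum f i + f i ≤ partialSum f j := by
  unfold partialSum
  rw [add_comm, ← Finset.sum_insert (by simp)]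
  refine Finset.sum_le_sum_of_subset_of_nonneg ?_ fun k _ _ => hf k
  intro k hk
  rw [Finset.mem_insert, Finset.mem_Iio] at hk
  rw [Finset.mem_Iio]
  rcases hk with rfl | hk
  · exact hij
  · exact hk.trans hij

theorem eq_of_mem_interval {f : Fin n → ℝ} (hf : ∀ i, 0 ≤ f i) {i j : Fin n} {t : ℝ}
    (hi : partialSum f i ≤ t) (hi' : t < partialSum f i + f i)
    (hj : partialSum f j ≤ t) (hj' : t < partialSum f j + f j) : i = j := by
  rcases lt_trichotomy i j with h | h | h
  · linarith [partialSum_add_le hf h]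
  · exact h
  · linarith [partialSum_add_le hf h]

theorem exists_partialSum_eq_zero {f : Fin n → ℝ} (hf : ∀ i, 0 ≤ f i) (h : ∃ i, 0 < f i) :
    ∃ i, 0 < f i ∧ partialSum f i = 0 := by
  classical
  obtain ⟨i, hi, hmin⟩ := (Set.toFinite {i | 0 < f i}).exists_minimal h
  refine ⟨i, hi, Finset.sum_eq_zero fun k hk => ?_⟩
  rw [Finset.mem_Iio] at hk
  by_contra hne
  exact absurd (hmin ((hf k).lt_of_ne' hne) hk.le) (not_le.2 hk)

/-- The intervals `[F i, F i + f i)` and `[G j, G j + g j)` overlap, where `F` and `G` are the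
partial sums of `f` and `g`. -/
def Overlap (f : Fin n → ℝ) (g : Fin m → ℝ) (p : Fin n × Fin m) : Prop :=
  max (partialSum f p.1) (partialSum g p.2) <
    min (partialSum f p.1 + f p.1) (partialSum g p.2 + g p.2)

theorem Overlap.pos {f : Fin n → ℝ} {g : Fin m → ℝ} {p : Fin n × Fin m} (h : Overlap f g p) :
    0 < f p.1 ∧ 0 < g p.2 := by
  simp only [Overlap, max_lt_iff, lt_min_iff] at h
  exact ⟨by linarith [h.1.1], by linarith [h.2.2]⟩

/-- The first nondegenerate interval of each family starts at `0`. -/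
theorem exists_overlap {f : Fin n → ℝ} {g : Fin m → ℝ} (hf : ∀ i, 0 ≤ f i) (hg : ∀ j, 0 ≤ g j)
    (hf' : ∃ i, 0 < f i) (hg' : ∃ j, 0 < g j) : ∃ p, Overlap f g p := by
  obtain ⟨i, hi, hi0⟩ := exists_partialSum_eq_zero hf hf'
  obtain ⟨j, hj, hj0⟩ := exists_partialSum_eq_zero hg hg'
  exact ⟨(i, j), by simp [Overlap, hi0, hj0, hi, hj]⟩

/-- An overlap is determined by its left endpoint, which is a left endpoint of a nondegenerate
interval of one of the families. Both families contribute the endpoint `0`, whence the strict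
inequality. -/
theorem ncard_overlap_lt {f : Fin n → ℝ} {g : Fin m → ℝ} (hf : ∀ i, 0 ≤ f i) (hg : ∀ j, 0 ≤ g j)
    (hf' : ∃ i, 0 < f i) (hg' : ∃ j, 0 < g j) :
    {p | Overlap f g p}.ncard < {i | 0 < f i}.ncard + {j | 0 < g j}.ncard := by
  set a : Set ℝ := partialSum f '' {i | 0 < f i}
  set b : Set ℝ := partialSum g '' {j | 0 < g j}
  have hinj : Set.InjOn (fun p : Fin n × Fin m => max (partialSum f p.1) (partialSum g p.2))
      {p | Overlap f g p} := by
    rintro ⟨i, j⟩ hp ⟨i', j'⟩ hp' heq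
    simp only [Set.mem_ofPred_eq, Overlap] at hp hp' heq
    have h1 := lt_min_iff.1 hp
    have h2 := lt_min_iff.1 hp'
    rw [← heq] at h2
    refine Prod.ext
      (eq_of_mem_interval hf (le_max_left _ _) h1.1 (heq ▸ le_max_left _ _) h2.1)
      (eq_of_mem_interval hg (le_max_right _ _) h1.2 (heq ▸ le_max_right _ _) h2.2)
  have hsub : (fun p : Fin n × Fin m => max (partialSum f p.1) (partialSum g p.2)) ''
      {p | Overlap f g p} ⊆ a ∪ b := by
    rintro _ ⟨p, hp, rfl⟩
    rcases max_choice (partialSum f p.1) (partialSum g p.2) with h | h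
    · exact Or.inl ⟨p.1, hp.pos.1, h.symm⟩
    · exact Or.inr ⟨p.2, hp.pos.2, h.symm⟩
  have hfa : a.Finite := Set.toFinite _
  have hfb : b.Finite := Set.toFinite _
  have h0 : 0 < (a ∩ b).ncard := by
    obtain ⟨i, hi, hi0⟩ := exists_partialSum_eq_zero hf hf'
    obtain ⟨j, hj, hj0⟩ := exists_partialSum_eq_zero hg hg'
    exact (Set.ncard_pos (hfa.inter_of_left b)).2 ⟨0, ⟨i, hi, hi0⟩, ⟨j, hj, hj0⟩⟩
  have h1 := Set.ncard_le_ncard hsub (hfa.union hfb)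
  rw [hinj.ncard_image] at h1
  have h2 := Set.ncard_union_add_ncard_inter a b hfa hfb
  have h3 : a.ncard ≤ _ := Set.ncard_image_le (Set.toFinite _)
  have h4 : b.ncard ≤ _ := Set.ncard_image_le (Set.toFinite _)
  omega

end Staircase

/-! ### Subadditivity of `D` under joins -/

section Join

variable {X : Type*} [TopologicalSpace X]

theorem continuous_partialSum {n : ℕ} {f : Fin n → X → ℝ} (hf : ∀ i, Continuous (f i))
    (i : Fin n) : Continuous fun x => partialSum (fun k => f k x) i :=
  continuous_finsetSum _ fun k _ => hf k

theorem D_le_add [NormalSpace X] {J J₁ J₂ : Type*} [Finite J₁] [Finite J₂]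
    {U : J → Opens X} {U₁ : J₁ → Opens X} {U₂ : J₂ → Opens X}
    (h₁ : IsOpenCover U₁) (h₂ : IsOpenCover U₂)
    (h : ∀ j₁ j₂, ∃ j, U₁ j₁ ⊓ U₂ j₂ ≤ U j) : D U ≤ D U₁ + D U₂ := by
  obtain ⟨n, V, hV, hVU, hVD⟩ := exists_order_eq_D h₁
  obtain ⟨m, W, hW, hWU, hWD⟩ := exists_order_eq_D h₂
  obtain ⟨f, hf⟩ := PartitionOfUnity.exists_isSubordinate_of_locallyFinite isClosed_univ
    (fun i => (V i : Set X)) (fun i => (V i).isOpen) (locallyFinite_of_finite _)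
    (fun x _ => Set.mem_iUnion.2 (hV.exists_mem x))
  obtain ⟨g, hg⟩ := PartitionOfUnity.exists_isSubordinate_of_locallyFinite isClosed_univ
    (fun i => (W i : Set X)) (fun i => (W i).isOpen) (locallyFinite_of_finite _)
    (fun x _ => Set.mem_iUnion.2 (hW.exists_mem x))
  have hfV : ∀ i x, 0 < f i x → x ∈ V i := fun i x hx =>
    hf i (subset_tsupport _ (Function.mem_support.2 hx.ne'))
  have hgW : ∀ i x, 0 < g i x → x ∈ W i := fun i x hx =>
    hg i (subset_tsupport _ (Function.mem_support.2 hx.ne'))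
  have hf0 := fun x => f.exists_pos (Set.mem_univ x)
  have hg0 := fun x => g.exists_pos (Set.mem_univ x)
  have hcf := continuous_partialSum fun i => (f i).continuous
  have hcg := continuous_partialSum fun i => (g i).continuous
  let O : Fin n × Fin m → Opens X := fun p =>
    ⟨{x | Overlap (fun i => f i x) (fun j => g j x) p}, isOpen_lt
      ((hcf p.1).max (hcg p.2))
      (((hcf p.1).add (f p.1).continuous).min ((hcg p.2).add (g p.2).continuous))⟩
  have hO : IsOpenCover O := by
    rw [IsOpenCover, eq_top_iff]
    intro x _
    rw [Opens.mem_iSup]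
    exact exists_overlap (fun i => f.nonneg i x) (fun j => g.nonneg j x) (hf0 x) (hg0 x)
  have hOU : Finer O U := by
    intro p
    obtain ⟨j₁, hj₁⟩ := hVU p.1
    obtain ⟨j₂, hj₂⟩ := hWU p.2
    obtain ⟨j, hj⟩ := h j₁ j₂
    refine ⟨j, le_trans (fun x hx => ?_) hj⟩
    have hx' : Overlap (fun i => f i x) (fun j => g j x) p := hx
    exact ⟨hj₁ (hfV _ _ hx'.pos.1), hj₂ (hgW _ _ hx'.pos.2)⟩
  -- The strict bound on overlaps absorbs the `-1` of the local order: `a < p + q` gives `a - 1 ≤ (p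
  -- - 1) + (q - 1)`.
  refine (D_le_order hO hOU).trans (order_le (add_nonneg (D_nonneg h₁) (D_nonneg h₂)) fun x => ?_)
  have hlt : {p | x ∈ O p}.ncard < _ :=
    ncard_overlap_lt (fun i => f.nonneg i x) (fun j => g.nonneg j x) (hf0 x) (hg0 x)
  have hle₁ : {i | 0 < f i x}.ncard ≤ {i | x ∈ V i}.ncard :=
    Set.ncard_le_ncard (fun i hi => hfV i x hi) (Set.toFinite _)
  have hle₂ : {j | 0 < g j x}.ncard ≤ {j | x ∈ W j}.ncard :=
    Set.ncard_le_ncard (fun i hi => hgW i x hi) (Set.toFinite _)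
  have h3 := localOrder_le_order V x
  have h4 := localOrder_le_order W x
  simp only [localOrder] at h3 h4 ⊢
  omega

end Join

/-! ### Properties of `hdim` as a set function -/

section Action

variable {S X : Type*} [TopologicalSpace X] [Semigroup S] [SemigroupAction S X]
  [ContinuousConstSMul S X] {J : Type*} {U : J → Opens X}

theorem mem_joinPullback {A : Finset S} {φ : A → J} {x : X} :
    x ∈ joinPullback U A φ ↔ ∀ s : A, (s : S) • x ∈ U (φ s) :=
  Set.mem_iInter

theorem hdim_empty_nonpos : hdim U (∅ : Finset S) ≤ 0 := by
  unfold hdim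
  have h : IsOpenCover fun _ : Unit => (⊤ : Opens X) := by simp [IsOpenCover]
  have hD : D (joinPullback U (∅ : Finset S)) ≤ order fun _ : Unit => (⊤ : Opens X) :=
    D_le_order h fun _ => ⟨fun s => absurd s.2 (Finset.notMem_empty _),
      fun x _ => mem_joinPullback.2 fun s => absurd s.2 (Finset.notMem_empty _)⟩
  have h0 : order (fun _ : Unit => (⊤ : Opens X)) ≤ 0 :=
    order_le le_rfl fun x => by simp [localOrder]
  exact_mod_cast hD.trans h0

variable [Finite J]

theorem hdim_nonneg (hU : IsOpenCover U) (A : Finset S) : 0 ≤ hdim U A :=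
  Int.cast_nonneg (D_nonneg (isOpenCover_joinPullback hU A))

open Classical in
theorem hdim_union_le [NormalSpace X] (hU : IsOpenCover U) (A B : Finset S) :
    hdim U (A ∪ B) ≤ hdim U A + hdim U B := by
  unfold hdim
  norm_cast
  refine D_le_add (isOpenCover_joinPullback hU A) (isOpenCover_joinPullback hU B) fun φ ψ => ?_
  refine ⟨fun s => if h : (s : S) ∈ A then φ ⟨s, h⟩ else
    ψ ⟨s, (Finset.mem_union.1 s.2).resolve_left h⟩, fun x hx => ?_⟩
  rw [mem_joinPullback]
  intro s
  split_ifs with h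
  · exact mem_joinPullback.1 hx.1 ⟨s, h⟩
  · exact mem_joinPullback.1 hx.2 ⟨s, (Finset.mem_union.1 s.2).resolve_left h⟩

open Classical in
-- Since `(a * c) • x = a • (c • x)`, pulling the cover for `A` back along `x ↦ c • x` refines the
-- cover for the translate.
theorem hdim_image_mul_right_le (hU : IsOpenCover U) (A : Finset S) (c : S) :
    hdim U (A.image (· * c)) ≤ hdim U A := by
  unfold hdim
  norm_cast
  refine D_le_of_comap_le (isOpenCover_joinPullback hU A)
    ⟨fun x => c • x, continuous_const_smul c⟩ fun φ => ?_
  choose g hg hgc using fun s : A.image (· * c) => Finset.mem_image.1 s.2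
  refine ⟨fun s => φ ⟨g s, hg s⟩, fun x hx => mem_joinPullback.2 fun s => ?_⟩
  rw [← hgc s, mul_smul]
  exact mem_joinPullback.1 (show c • x ∈ joinPullback U A φ from hx) ⟨g s, hg s⟩

theorem hdim_singleton_le (hU : IsOpenCover U) (s : S) : hdim U {s} ≤ D U := by
  unfold hdim
  norm_cast
  refine D_le_of_comap_le hU ⟨fun x => s • x, continuous_const_smul s⟩ fun j => ?_
  refine ⟨fun _ => j, fun x hx => mem_joinPullback.2 ?_⟩
  rintro ⟨t, ht⟩
  obtain rfl := Finset.mem_singleton.1 ht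
  exact hx

end Action

/-! ### An Ornstein–Weiss lemma for cancellative semigroups -/

section Fekete

open Classical in
/-- The number of pairs `(e, c)` in `E × R` whose product leaves `R`. -/
noncomputable def escape {S : Type*} [Semigroup S] (E R : Finset S) : ℕ :=
  ∑ e ∈ E, {c ∈ R | e * c ∉ R}.card

open Classical in
/-- A nonnegative real-valued function on the finite subsets of a semigroup which is subadditive,
does not increase under right translation, and is bounded by `M` on singletons. -/
structure IsSubadditive {S : Type*} [Semigroup S] (h : Finset S → ℝ) (M : ℝ) : Prop where
  nonneg : ∀ A, 0 ≤ h A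
  empty : h ∅ ≤ 0
  union : ∀ A B, h (A ∪ B) ≤ h A + h B
  image : ∀ A c, h (A.image (· * c)) ≤ h A
  singleton : ∀ s, h {s} ≤ M

variable {S : Type*} [Semigroup S]

theorem IsSubadditive.le_card {h : Finset S → ℝ} {M : ℝ} (hh : IsSubadditive h M)
    (A : Finset S) : h A ≤ M * A.card := by
  classical
  induction A using Finset.induction_on with
  | empty => simpa using hh.empty
  | insert a A ha ih =>
    rw [Finset.insert_eq, Finset.card_union_of_disjoint (by simpa using ha)]
    have h1 := hh.union {a} A
    have h2 := hh.singleton a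
    push_cast [Finset.card_singleton]
    linarith

open Classical in
theorem card_filter_mul_notMem [IsCancelMul S] (l : S) (F : Finset S) :
    {c ∈ F | l * c ∉ F}.card = (F.image (l * ·) \ F).card := by
  rw [← Finset.card_image_of_injective {c ∈ F | l * c ∉ F} (mul_right_injective l)]
  congr 1
  ext x
  simp only [Finset.mem_image, Finset.mem_filter, Finset.mem_sdiff]
  constructor
  · rintro ⟨c, ⟨hc, hc'⟩, rfl⟩
    exact ⟨⟨c, hc, rfl⟩, hc'⟩
  · rintro ⟨⟨c, hc, rfl⟩, hc'⟩
    exact ⟨c, ⟨hc, hc'⟩, rfl⟩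

open Classical in
/-- The points outside a right translate of `K` which `l` moves into it are at most as many as the
points of `K` which `l` moves out of `K`. -/
theorem card_filter_mul_mem_image_le [IsCancelMul S] (K R : Finset S) (c l : S) :
    {x ∈ R | x ∉ K.image (· * c) ∧ l * x ∈ K.image (· * c)}.card ≤ {k ∈ K | l * k ∉ K}.card := by
  set L := K.image (· * c)
  have h1 : {x ∈ R | x ∉ L ∧ l * x ∈ L}.card ≤ (L \ L.image (l * ·)).card := by
    refine Finset.card_le_card_of_injOn (l * ·) ?_ (mul_right_injective l).injOn
    intro x hx
    obtain ⟨-, hx, hx'⟩ := Finset.mem_filter.1 hx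
    refine Finset.mem_sdiff.2 ⟨hx', fun hmem => ?_⟩
    obtain ⟨y, hy, hyx⟩ := Finset.mem_image.1 hmem
    exact hx (mul_left_cancel hyx ▸ hy)
  -- `L` and its left translate have equal cardinality, so as many points enter as leave.
  have h2 : (L \ L.image (l * ·)).card = (L.image (l * ·) \ L).card := by
    refine Finset.card_sdiff_comm ?_
    rw [Finset.card_image_of_injective _ (mul_right_injective l)]
  have h3 : {y ∈ L | l * y ∉ L}.card ≤ {k ∈ K | l * k ∉ K}.card := by
    have hsub : {y ∈ L | l * y ∉ L} ⊆ {k ∈ K | l * k ∉ K}.image (· * c) := by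
      intro y hy
      obtain ⟨hy, hy'⟩ := Finset.mem_filter.1 hy
      obtain ⟨k, hk, rfl⟩ := Finset.mem_image.1 hy
      refine Finset.mem_image_of_mem _ (Finset.mem_filter.2 ⟨hk, fun hlk => hy' ?_⟩)
      exact Finset.mem_image.2 ⟨l * k, hlk, mul_assoc _ _ _⟩
    exact (Finset.card_le_card hsub).trans Finset.card_image_le
  rw [h2, ← card_filter_mul_notMem] at h1
  exact h1.trans h3

open Classical in
/-- A union of almost disjoint right translates of `K` inside `R`, `m` in number. -/
structure IsTiled (h : Finset S → ℝ) (ε : ℝ) (K R A : Finset S) (m : ℕ) : Prop where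
  subset : A ⊆ R
  le : h A ≤ m * h K
  card_le : (1 - ε) * (m * K.card) ≤ A.card
  boundary_le : ∀ l : S, {x ∈ R | x ∉ A ∧ l * x ∈ A}.card ≤ m * {k ∈ K | l * k ∉ K}.card

open Classical in
theorem IsTiled.union [IsCancelMul S] {h : Finset S → ℝ} {M ε : ℝ} (hh : IsSubadditive h M)
    {K R A : Finset S} {m : ℕ} (hA : IsTiled h ε K R A m) {c : S}
    (hc : K.image (· * c) ⊆ R) (hcA : ((K.image (· * c) ∩ A).card : ℝ) ≤ ε * K.card) :
    IsTiled h ε K R (A ∪ K.image (· * c)) (m + 1) where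
  subset := Finset.union_subset hA.subset hc
  le := by
    have h1 := hh.union A (K.image (· * c))
    have h2 := hh.image K c
    have h3 := hA.le
    push_cast
    linarith
  card_le := by
    have h1 := Finset.card_union_add_card_inter A (K.image (· * c))
    rw [Finset.inter_comm, Finset.card_image_of_injective K (mul_left_injective c)] at h1
    have h2 : ((A ∪ K.image (· * c)).card : ℝ) + (K.image (· * c) ∩ A).card
      = A.card + K.card := by exact_mod_cast h1
    have h3 := hA.card_le
    push_cast
    linarith
  boundary_le l := by
    have hsub : {x ∈ R | x ∉ A ∪ K.image (· * c) ∧ l * x ∈ A ∪ K.image (· * c)} ⊆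
        {x ∈ R | x ∉ A ∧ l * x ∈ A} ∪
          {x ∈ R | x ∉ K.image (· * c) ∧ l * x ∈ K.image (· * c)} := by
      intro x
      simp only [Finset.mem_filter, Finset.mem_union]
      tauto
    refine (Finset.card_le_card hsub).trans ((Finset.card_union_le _ _).trans ?_)
    rw [add_one_mul]
    exact add_le_add (hA.boundary_le l) (card_filter_mul_mem_image_le K R c l)

/-- Filling: almost disjoint right translates of `K` cover a proportion `ε` of the points `c` of
`R` for which the translate of `K` by `c` lies in `R`. -/
theorem exists_isTiled [IsCancelMul S] {h : Finset S → ℝ} {M ε : ℝ} (hh : IsSubadditive h M)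
    (hε : 0 < ε) (hε' : ε < 1) {K : Finset S} (hK : K.Nonempty) (R : Finset S) :
    ∃ A m, IsTiled h ε K R A m ∧ ε * (R.card - escape K R) ≤ A.card := by
  classical
  have hK0 : (0 : ℝ) < K.card := by exact_mod_cast hK.card_pos
  have hne : {A ∈ R.powerset | ∃ m, IsTiled h ε K R A m}.Nonempty := by
    refine ⟨∅, Finset.mem_filter.2 ⟨by simp, 0, ?_⟩⟩
    exact ⟨by simp, by simpa using hh.empty, by simp, by simp⟩
  -- Maximality is in the cardinality of `A`, not in `m`. If a translate met `A` in fewer than `ε *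
  -- K.card` points, adding it could not enlarge `A`, so it would already lie in `A`.
  obtain ⟨A, hA, hmax⟩ := Finset.exists_max_image _ Finset.card hne
  obtain ⟨-, m, hA⟩ := Finset.mem_filter.1 hA
  refine ⟨A, m, hA, ?_⟩
  set C := {c ∈ R | K.image (· * c) ⊆ R} with hC
  have hmeet : ∀ c ∈ C, ε * K.card ≤ ((K.image (· * c) ∩ A).card : ℝ) := by
    intro c hc
    by_contra! hlt
    have hB := hA.union hh (Finset.mem_filter.1 hc).2 hlt.le
    have hle := hmax _ (Finset.mem_filter.2 ⟨Finset.mem_powerset.2 hB.subset, _, hB⟩)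
    have heq : A = A ∪ K.image (· * c) :=
      Finset.eq_of_subset_of_card_le Finset.subset_union_left hle
    have hsub : K.image (· * c) ⊆ A := by
      rw [heq]
      exact Finset.subset_union_right
    rw [Finset.inter_eq_left.2 hsub,
      Finset.card_image_of_injective K (mul_left_injective c)] at hlt
    nlinarith
  -- Double counting of the pairs with `k * c ∈ A`; by left cancellation each `k` occurs in at most
  -- `A.card` of them.
  have hcount : ∑ c ∈ C, (K.image (· * c) ∩ A).card ≤ K.card * A.card := by
    calc ∑ c ∈ C, (K.image (· * c) ∩ A).card
        = ∑ c ∈ C, {k ∈ K | k * c ∈ A}.card := by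
          refine Finset.sum_congr rfl fun c _ => ?_
          rw [← Finset.card_image_of_injective {k ∈ K | k * c ∈ A} (mul_left_injective c)]
          congr 1
          ext x
          simp only [Finset.mem_inter, Finset.mem_image, Finset.mem_filter]
          constructor
          · rintro ⟨⟨k, hk, rfl⟩, hx⟩
            exact ⟨k, ⟨hk, hx⟩, rfl⟩
          · rintro ⟨k, ⟨hk, hx⟩, rfl⟩
            exact ⟨⟨k, hk, rfl⟩, hx⟩
      _ = ∑ k ∈ K, {c ∈ C | k * c ∈ A}.card :=
          Finset.sum_card_bipartiteAbove_eq_sum_card_bipartiteBelow fun c k => k * c ∈ A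
      _ ≤ ∑ k ∈ K, A.card := by
          refine Finset.sum_le_sum fun k _ => ?_
          exact Finset.card_le_card_of_injOn (k * ·) (fun c hc => (Finset.mem_filter.1 hc).2)
            (mul_right_injective k).injOn
      _ = K.card * A.card := by simp
  have hCA : ε * C.card ≤ A.card := by
    have h1 := Finset.sum_le_sum hmeet
    have h2 : (∑ c ∈ C, ((K.image (· * c) ∩ A).card : ℝ)) ≤ K.card * A.card := by
      exact_mod_cast hcount
    rw [Finset.sum_const, nsmul_eq_mul] at h1
    have h3 : K.card * (ε * C.card) ≤ K.card * (A.card : ℝ) := by linarith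
    exact le_of_mul_le_mul_left h3 hK0
  have hRC : R.card ≤ C.card + escape K R := by
    have hsub : R ⊆ C ∪ K.biUnion fun e => {c ∈ R | e * c ∉ R} := by
      intro c hc
      by_cases hcC : c ∈ C
      · exact Finset.mem_union_left _ hcC
      · refine Finset.mem_union_right _ ?_
        have : ¬ K.image (· * c) ⊆ R := fun hsub => hcC (Finset.mem_filter.2 ⟨hc, hsub⟩)
        rw [Finset.image_subset_iff] at this
        push Not at this
        obtain ⟨k, hk, hkc⟩ := this
        exact Finset.mem_biUnion.2 ⟨k, hk, Finset.mem_filter.2 ⟨hc, hkc⟩⟩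
    exact (Finset.card_le_card hsub).trans ((Finset.card_union_le _ _).trans
      (Nat.add_le_add_left Finset.card_biUnion_le _))
  have hRC' : (R.card : ℝ) - escape K R ≤ C.card := by
    rw [sub_le_iff_le_add]
    exact_mod_cast hRC
  exact (mul_le_mul_of_nonneg_left hRC' hε.le).trans hCA

open Classical in
-- A point leaving `R \ A` either leaves `R` or enters `A`.
theorem IsTiled.escape_sdiff_le {h : Finset S → ℝ} {ε : ℝ} {K R A : Finset S} {m : ℕ}
    (hA : IsTiled h ε K R A m) (E : Finset S) :
    escape E (R \ A) ≤ escape E R + m * escape E K := by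
  unfold escape
  rw [Finset.mul_sum, ← Finset.sum_add_distrib]
  refine Finset.sum_le_sum fun e _ => ?_
  have hsub : {c ∈ R \ A | e * c ∉ R \ A} ⊆
      {c ∈ R | e * c ∉ R} ∪ {x ∈ R | x ∉ A ∧ e * x ∈ A} := by
    intro x
    simp only [Finset.mem_filter, Finset.mem_union, Finset.mem_sdiff]
    tauto
  exact (Finset.card_le_card hsub).trans ((Finset.card_union_le _ _).trans
    (Nat.add_le_add_left (hA.boundary_le e) _))

theorem escape_mono_left {E E' : Finset S} (hE : E ⊆ E') (R : Finset S) :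
    escape E R ≤ escape E' R :=
  Finset.sum_le_sum_of_subset hE

open Classical in
/-- All sufficiently invariant finite sets satisfy `h ≤ a * card` after the removal of a
proportion `r` of their points. -/
def HasLargePart (h : Finset S → ℝ) (a r : ℝ) : Prop :=
  ∃ (E : Finset S) (θ : ℝ), 0 < θ ∧ ∀ (R : Finset S) (N : ℝ), R.card ≤ N →
    escape E R ≤ θ * N → ∃ B ⊆ R, h (R \ B) ≤ a * (R \ B).card ∧ B.card ≤ r * N

theorem HasLargePart.one {h : Finset S → ℝ} {M : ℝ} (hh : IsSubadditive h M) (a : ℝ) :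
    HasLargePart h a 1 := by
  classical
  refine ⟨∅, 1, one_pos, fun R N hN _ => ⟨R, subset_rfl, ?_, by simpa using hN⟩⟩
  simpa using hh.empty

/-- One round of filling with a tile `K` chosen to be invariant for the data `E`, `θ` of the later
rounds. Invariance is measured against `N` because `R \ A` may be far smaller than the bound `q *
N`. -/
theorem HasLargePart.step [IsCancelMul S] {h : Finset S → ℝ} {M ε b r : ℝ} (hh : IsSubadditive h M)
    (hε : 0 < ε) (hε' : ε < 1)
    (hK : ∀ (E : Finset S) (δ : ℝ), 0 < δ →
      ∃ K : Finset S, K.Nonempty ∧ escape E K ≤ δ * K.card ∧ h K ≤ b * K.card)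
    (hr : HasLargePart h (b / (1 - ε)) r) :
    HasLargePart h (b / (1 - ε)) ((1 - ε / 2) * r) := by
  classical
  obtain ⟨E, θ, hθ, H⟩ := hr
  have h1ε : 0 < 1 - ε := by linarith
  set q := 1 - ε / 2 with hq
  have hq0 : 0 < q := by linarith
  -- As `m * ((1 - ε) * K.card) ≤ A.card ≤ N`, this constant makes all tiles together contribute at
  -- most half of the allowed escape `θ * (q * N)`.
  obtain ⟨K, hKne, hKE, hKb⟩ := hK E ((1 - ε) * (θ * q / 2)) (by positivity)
  have hK0 : (0 : ℝ) < K.card := by exact_mod_cast hKne.card_pos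
  have hb : 0 ≤ b := nonneg_of_mul_nonneg_left ((hh.nonneg K).trans hKb) hK0
  -- The `1 / 2` ensures `A.card ≥ ε * (R.card - N / 2)`, hence the factor `q`; the other entry is
  -- the half of the escape left to `R`.
  refine ⟨E ∪ K, min (1 / 2) (θ * q / 2), by positivity, fun R N hN hR => ?_⟩
  have hN0 : 0 ≤ N := (Nat.cast_nonneg _).trans hN
  obtain ⟨A, m, hA, hcard⟩ := exists_isTiled hh hε hε' hKne R
  have hRK : (escape K R : ℝ) ≤ 1 / 2 * N :=
    (Nat.cast_le.2 (escape_mono_left Finset.subset_union_right R)).trans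
      (hR.trans (mul_le_mul_of_nonneg_right (min_le_left _ _) hN0))
  have hRE : (escape E R : ℝ) ≤ θ * q / 2 * N :=
    (Nat.cast_le.2 (escape_mono_left Finset.subset_union_left R)).trans
      (hR.trans (mul_le_mul_of_nonneg_right (min_le_right _ _) hN0))
  have hAR : (A.card : ℝ) ≤ R.card := Nat.cast_le.2 (Finset.card_le_card hA.subset)
  have hsd : ((R \ A).card : ℝ) = R.card - A.card := by
    rw [Finset.card_sdiff_of_subset hA.subset, Nat.cast_sub (Finset.card_le_card hA.subset)]
  have hsd' : ((R \ A).card : ℝ) ≤ q * N := by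
    rw [hsd]
    nlinarith
  have hmA : (m : ℝ) * ((1 - ε) * K.card) ≤ A.card := by linarith [hA.card_le]
  have hesc : (escape E (R \ A) : ℝ) ≤ θ * (q * N) := by
    have h1 : (escape E (R \ A) : ℝ) ≤ escape E R + m * escape E K := by
      exact_mod_cast hA.escape_sdiff_le E
    have h2 : (m : ℝ) * escape E K ≤ m * ((1 - ε) * (θ * q / 2) * K.card) :=
      mul_le_mul_of_nonneg_left hKE (Nat.cast_nonneg _)
    have h3 : θ * q / 2 * (m * ((1 - ε) * K.card)) ≤ θ * q / 2 * N :=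
      mul_le_mul_of_nonneg_left (hmA.trans (hAR.trans hN)) (by positivity)
    linarith
  obtain ⟨B, hB, hB1, hB2⟩ := H (R \ A) (q * N) hsd' hesc
  refine ⟨B, hB.trans Finset.sdiff_subset, ?_, by linarith⟩
  have hdisj : Disjoint A ((R \ A) \ B) :=
    Finset.disjoint_sdiff.mono_right Finset.sdiff_subset
  have hunion : R \ B = A ∪ ((R \ A) \ B) := by
    ext x
    have h1 : x ∈ A → x ∈ R := fun hx => hA.subset hx
    have h2 : x ∈ B → x ∈ R \ A := fun hx => hB hx
    simp only [Finset.mem_union, Finset.mem_sdiff] at h2 ⊢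
    tauto
  have hAb : h A ≤ b / (1 - ε) * A.card := by
    have h1 : (m : ℝ) * h K ≤ m * (b * K.card) :=
      mul_le_mul_of_nonneg_left hKb (Nat.cast_nonneg _)
    have h2 : b / (1 - ε) * (m * ((1 - ε) * K.card)) ≤ b / (1 - ε) * A.card :=
      mul_le_mul_of_nonneg_left hmA (by positivity)
    have h3 : b / (1 - ε) * (m * ((1 - ε) * K.card)) = m * (b * K.card) := by
      field_simp
    linarith [hA.le]
  rw [hunion, Finset.card_union_of_disjoint hdisj]
  push_cast
  linarith [hh.union A ((R \ A) \ B)]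

theorem hasLargePart_pow [IsCancelMul S] {h : Finset S → ℝ} {M ε b : ℝ} (hh : IsSubadditive h M)
    (hε : 0 < ε) (hε' : ε < 1)
    (hK : ∀ (E : Finset S) (δ : ℝ), 0 < δ →
      ∃ K : Finset S, K.Nonempty ∧ escape E K ≤ δ * K.card ∧ h K ≤ b * K.card) (n : ℕ) :
    HasLargePart h (b / (1 - ε)) ((1 - ε / 2) ^ n) := by
  induction n with
  | zero => simpa using HasLargePart.one hh _
  | succ n ih =>
    rw [pow_succ']
    exact ih.step hh hε hε' hK

/-- `h ≤ a * card` on all sufficiently invariant finite sets. -/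
def EventuallyLe (h : Finset S → ℝ) (a : ℝ) : Prop :=
  ∃ (E : Finset S) (θ : ℝ), 0 < θ ∧ ∀ R : Finset S, escape E R ≤ θ * R.card → h R ≤ a * R.card

/-- If there are arbitrarily invariant sets with `h ≤ b * card`, then `h ≤ a * card` holds on all
sufficiently invariant sets, for every `a > b`. -/
theorem eventuallyLe_of_lt [IsCancelMul S] {h : Finset S → ℝ} {M a b : ℝ} (hh : IsSubadditive h M)
    (hK : ∀ (E : Finset S) (δ : ℝ), 0 < δ →
      ∃ K : Finset S, K.Nonempty ∧ escape E K ≤ δ * K.card ∧ h K ≤ b * K.card) (hab : b < a) :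
    EventuallyLe h a := by
  classical
  obtain ⟨K, hKne, -, hKb⟩ := hK ∅ 1 one_pos
  have hK0 : (0 : ℝ) < K.card := by exact_mod_cast hKne.card_pos
  have hb : 0 ≤ b := nonneg_of_mul_nonneg_left ((hh.nonneg K).trans hKb) hK0
  have hM : 0 ≤ M := by
    obtain ⟨s, -⟩ := hKne
    exact (hh.nonneg {s}).trans (hh.singleton s)
  have hlim : Tendsto (fun ε : ℝ => b / (1 - ε) + M * ε) (𝓝[>] 0) (𝓝 b) := by
    have : ContinuousAt (fun ε : ℝ => b / (1 - ε) + M * ε) 0 := by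
      refine ContinuousAt.add (ContinuousAt.div continuousAt_const (by fun_prop) (by norm_num)) ?_
      fun_prop
    have h0 := this.tendsto
    simp only [sub_zero, div_one, mul_zero, add_zero] at h0
    exact h0.mono_left nhdsWithin_le_nhds
  -- The tiled part costs `b / (1 - ε)` per point, and the remainder, a proportion below `ε` after
  -- `n` rounds, adds `M * ε`.
  obtain ⟨ε, hεa, hε0, hε1⟩ :=
    ((hlim.eventually_lt_const hab).and (Ioo_mem_nhdsGT (zero_lt_one' ℝ))).exists
  obtain ⟨n, hn⟩ := exists_pow_lt_of_lt_one hε0 (show 1 - ε / 2 < 1 by linarith)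
  obtain ⟨E, θ, hθ, H⟩ := hasLargePart_pow hh hε0 hε1 hK n
  refine ⟨E, θ, hθ, fun R hR => ?_⟩
  obtain ⟨B, hBR, hB1, hB2⟩ := H R R.card le_rfl hR
  have h1 := hh.union (R \ B) B
  rw [Finset.sdiff_union_of_subset hBR] at h1
  have h2 : b / (1 - ε) * (R \ B).card ≤ b / (1 - ε) * R.card :=
    mul_le_mul_of_nonneg_left (Nat.cast_le.2 (Finset.card_le_card Finset.sdiff_subset))
      (div_nonneg hb (by linarith))
  have hR0 : (0 : ℝ) ≤ R.card := Nat.cast_nonneg _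
  have h3 : h B ≤ M * (ε * R.card) := (hh.le_card B).trans
    (mul_le_mul_of_nonneg_left (hB2.trans (mul_le_mul_of_nonneg_right hn.le hR0)) hM)
  have h4 := mul_le_mul_of_nonneg_right hεa.le hR0
  linarith

theorem IsLeftFolnerNet.eventually_escape_le [IsCancelMul S] {I : Type*} [Preorder I]
    {F : I → Finset S}
    (hF : IsLeftFolnerNet F) (E : Finset S) {δ : ℝ} (hδ : 0 < δ) :
    ∀ᶠ i in atTop, (escape E (F i) : ℝ) ≤ δ * (F i).card := by
  classical
  have hlim : Tendsto (fun i => (escape E (F i) : ℝ) / (F i).card) atTop (𝓝 0) := by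
    have := tendsto_finsetSum E fun e _ => hF.2 e
    rw [Finset.sum_const_zero] at this
    refine this.congr fun i => ?_
    rw [escape, Nat.cast_sum, Finset.sum_div]
    refine Finset.sum_congr rfl fun e _ => ?_
    rw [card_filter_mul_notMem]
  filter_upwards [hlim.eventually_lt_const hδ] with i hi
  have : (0 : ℝ) < (F i).card := by exact_mod_cast (hF.1 i).card_pos
  exact ((div_lt_iff₀ this).1 hi).le

/-- The limit of `h / card` along left-Følner nets. -/
noncomputable def folnerLimit (h : Finset S → ℝ) : ℝ := sInf {a | 0 ≤ a ∧ EventuallyLe h a}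

theorem IsSubadditive.tendsto_folnerLimit [IsCancelMul S] {h : Finset S → ℝ} {M : ℝ}
    (hh : IsSubadditive h M)
    {I : Type*} [Preorder I] [IsDirectedOrder I] [Nonempty I] {F : I → Finset S}
    (hF : IsLeftFolnerNet F) :
    Tendsto (fun i => h (F i) / (F i).card) atTop (𝓝 (folnerLimit h)) := by
  have hpos : ∀ i, (0 : ℝ) < (F i).card := fun i => by exact_mod_cast (hF.1 i).card_pos
  have hbdd : BddBelow {a | 0 ≤ a ∧ EventuallyLe h a} := ⟨0, fun a ha => ha.1⟩
  have hne : {a | 0 ≤ a ∧ EventuallyLe h a}.Nonempty := by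
    obtain ⟨s, -⟩ := hF.1 (Classical.arbitrary I)
    exact ⟨M, (hh.nonneg {s}).trans (hh.singleton s), ∅, 1, one_pos, fun R _ => hh.le_card R⟩
  refine tendsto_order.2 ⟨fun b hb => ?_, fun a ha => ?_⟩
  -- Ratios recurring below `b` supply the tiles of `eventuallyLe_of_lt`, which then puts some `a`
  -- below the infimum into its defining set.
  · by_contra hcon
    have hfreq : ∃ᶠ i in atTop, h (F i) / (F i).card ≤ b :=
      (not_eventually.1 hcon).mono fun i hi => not_lt.1 hi
    have hK : ∀ (E : Finset S) (δ : ℝ), 0 < δ →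
        ∃ K : Finset S, K.Nonempty ∧ escape E K ≤ δ * K.card ∧ h K ≤ b * K.card := by
      intro E δ hδ
      obtain ⟨i, hi, hi'⟩ := (hfreq.and_eventually (hF.eventually_escape_le E hδ)).exists
      exact ⟨F i, hF.1 i, hi', (div_le_iff₀ (hpos i)).1 hi⟩
    obtain ⟨a, hba, haη⟩ := exists_between hb
    obtain ⟨i, hi⟩ := hfreq.exists
    have ha0 : 0 ≤ a := (div_nonneg (hh.nonneg _) (hpos i).le).trans (hi.trans hba.le)
    exact absurd (csInf_le hbdd ⟨ha0, eventuallyLe_of_lt hh hK hba⟩) (not_le.2 haη)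
  · obtain ⟨a', ⟨-, E, θ, hθ, H⟩, ha'⟩ := exists_lt_of_csInf_lt hne ha
    filter_upwards [hF.eventually_escape_le E hθ] with i hi
    exact ((div_le_iff₀ (hpos i)).2 (H _ hi)).trans_lt ha'

end Fekete

end MeanDim

theorem mainTheorem6 {S X : Type*} [Semigroup S] [IsCancelMul S]
    (hS : MeanDim.LeftAmenable S)
    [TopologicalSpace X] [CompactSpace X] [MetrizableSpace X]
    [SemigroupAction S X] [ContinuousConstSMul S X]
    {J : Type*} [Finite J] (U : J → Opens X) (hU : IsOpenCover U) :
    ∃ η : ℝ, ∀ (I : Type*) [Preorder I] [IsDirectedOrder I] [Nonempty I] (F : I → Finset S),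
      MeanDim.IsLeftFolnerNet F →
        Tendsto (fun i => MeanDim.hdim U (F i) / ((F i).card : ℝ)) atTop (𝓝 η) := by
  have hh : MeanDim.IsSubadditive (MeanDim.hdim (S := S) U) (MeanDim.D U) :=
    { nonneg := MeanDim.hdim_nonneg hU
      empty := MeanDim.hdim_empty_nonpos
      union := MeanDim.hdim_union_le hU
      image := MeanDim.hdim_image_mul_right_le hU
      singleton := MeanDim.hdim_singleton_le hU }
  exact ⟨MeanDim.folnerLimit (MeanDim.hdim U), fun I _ _ _ F hF => hh.tendsto_folnerLimit hF⟩
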